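/- Let $n\ge 1$ be an integer and let $\zeta\in\mathbb{R}$ be not algebraic of degree $\le n$ over $\mathbb{Q}$. Define the following constants in $[-\infty,\infty]$. - $w_n'(\zeta)$ (respectively $\widehat w_n'(\zeta)$) is the supremum of all real $\nu$ such that the system $|x|\le X$, $|\zeta^i x-y_i|\le X^{-\nu}$ $(1\le i\le n)$ has a non-zero solution $(x,y_1,\dots,y_n)\in\mathbb{Z}^{n+1}$ for arbitrarily large real $X$ (respectively for all sufficiently large real $X$). - For an algebraic number $\alpha\in\mathbb{C}$ let $H(\alpha)$ be the largest absolute value of the coefficients of its minimal polynomial with relatively prime integral coefficients. Then $w_n^*(\zeta)$ is the supremum of all real $\nu$ such that $|\zeta-\alpha|\le H(\alpha)^{-\nu-1}$ has infinitely many solutions in algebraic numbers $\alpha$ of degree $\le n$, and $\widehat w_n^*(\zeta)$ is the supremum of all real $\nu$ such that for all sufficiently large real $H$ there is an algebraic number $\alpha$ of degree $\le n$ with $H(\alpha)\le H$ and $|\zeta-\alpha|\le H(\alpha)^{-1}H^{-\nu}$. Then $\widehat w_n'(\zeta)>0$, $w_n'(\zeta)>0$, and $$w_n^*(\zeta)\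 \ge\ \frac{1}{\widehat w_n'(\zeta)},\qquad \widehat w_n^*(\zeta)\ \ge\ \frac{1}{w_n'(\zeta)}\qquad\Bigl(\text{with } \tfrac1\infty=0\Bigr),$$ and moreover $$w_n^*(\zeta)\,\widehat w_n'(\zeta)\ \ge\ 1,\qquad \widehat w_n^*(\zeta)\,w_n'(\zeta)\ \ge\ 1\qquad\bigl(\text{with } a\cdot\infty=\infty \text{ for } 0<a\le\infty \text{ and } 0\cdot\infty=0\bigr).$$ -/

import Mathlib

open Filter Polynomial

noncomputable section

namespace DiophApprox

/-- `x` is algebraic (over the rationals) of degree at most `n`. -/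
def AlgebraicOfDegreeLE {A : Type*} [Ring A] [Algebra ℚ A] (n : ℕ) (x : A) : Prop :=
  IsAlgebraic ℚ x ∧ (minpoly ℚ x).natDegree ≤ n

/-- The height of an integer polynomial: the largest absolute value of its coefficients. -/
def polyHeight (P : ℤ[X]) : ℕ :=
  P.support.sup fun i => (P.coeff i).natAbs

/-- The minimal polynomial of an algebraic number with relatively prime integral coefficients
(determined up to sign): clear the denominators of the rational minimal polynomial and divide by
the greatest common divisor of the coefficients. -/
def primitiveMinpoly (α : ℂ) : ℤ[X] :=
  (IsLocalization.integerNormalization (nonZeroDivisors ℤ) (minpoly ℚ α)).primPart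

/-- The height `H(α)` of an algebraic number `α`: the height of its minimal polynomial with
relatively prime integral coefficients. -/
def algHeight (α : ℂ) : ℕ :=
  polyHeight (primitiveMinpoly α)

/-- The system `|x| ≤ X`, `|ξ_i x - y_i| ≤ X ^ (-ν)` for all `i` has a nonzero integer solution
`(x, y_1, …, y_n)` (that is, one linearly independent solution). -/
def SimulSolvable {n : ℕ} (ξ : Fin n → ℝ) (ν X : ℝ) : Prop :=
  ∃ (x : ℤ) (y : Fin n → ℤ), (x, y) ≠ 0 ∧
    |(x : ℝ)| ≤ X ∧ ∀ i, |ξ i * (x : ℝ) - (y i : ℝ)| ≤ X ^ (-ν)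

/-- The vector `(ζ, ζ ^ 2, …, ζ ^ n)`. -/
def powerVec (n : ℕ) (ζ : ℝ) : Fin n → ℝ :=
  fun i => ζ ^ (i.val + 1)

/-- `w_n'(ζ)`: the supremum of the real `ν` for which the system is solvable for arbitrarily large
`X`. -/
def wPrime (n : ℕ) (ζ : ℝ) : EReal :=
  ⨆ (ν : ℝ) (_ : ∃ᶠ X : ℝ in atTop, SimulSolvable (powerVec n ζ) ν X), (ν : EReal)

/-- `ŵ_n'(ζ)`: the supremum of the real `ν` for which the system is solvable for all sufficiently
large `X`. -/
def wHatPrime (n : ℕ) (ζ : ℝ) : EReal :=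
  ⨆ (ν : ℝ) (_ : ∀ᶠ X : ℝ in atTop, SimulSolvable (powerVec n ζ) ν X), (ν : EReal)

/-- `w_n^*(ζ)`: the supremum of the real `ν` for which `|ζ - α| ≤ H(α) ^ (-ν - 1)` has infinitely
many solutions in algebraic numbers `α` of degree at most `n`. -/
def wStar (n : ℕ) (ζ : ℝ) : EReal :=
  ⨆ (ν : ℝ) (_ : {α : ℂ | AlgebraicOfDegreeLE n α ∧
      ‖(ζ : ℂ) - α‖ ≤ (algHeight α : ℝ) ^ (-ν - 1)}.Infinite), (ν : EReal)

/-- `ŵ_n^*(ζ)`: the supremum of the real `ν` such that for all sufficiently large `H` there is an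
algebraic number `α` of degree at most `n` with `H(α) ≤ H` and
`|ζ - α| ≤ H(α) ^ (-1) * H ^ (-ν)`. -/
def wHatStar (n : ℕ) (ζ : ℝ) : EReal :=
  ⨆ (ν : ℝ) (_ : ∀ᶠ H : ℝ in atTop, ∃ α : ℂ, AlgebraicOfDegreeLE n α ∧
      (algHeight α : ℝ) ≤ H ∧
      ‖(ζ : ℂ) - α‖ ≤ (algHeight α : ℝ)⁻¹ * H ^ (-ν)), (ν : EReal)

end DiophApprox

end

namespace DiophApprox

/-! The engine is duality of lattices. If the simultaneous system has no non-zero solution at `X`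
with bound `X ^ (-ν)`, a rescaled lattice has no short non-zero vector, so its dual lattice comes
within a constant of every target (`exists_int_linearForm_near`). Dual vectors are coefficient
vectors of integer polynomials `P` of degree at most `n`. A suitable target makes `P(ζ)` of size
`O(1/X)` while `|P'(ζ)|` is at least `Q = X ^ ν` and all coefficients are `O(Q)`.

Such a `P` has a root `α` with `|ζ - α| ≤ n |P(ζ)| / |P'(ζ)|`, and `H(α) = O(Q)` by Mahler measure,
whence `|ζ - α| = O(H(α)⁻¹ Q ^ (-1/ν))` (`exists_hasAlgebraicApprox_of_not_simulSolvable`). Failure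
at arbitrarily large `X` bounds `wStar`; failure at all large `X` bounds `wHatStar`. Dirichlet's
theorem gives positivity, which settles the infinite cases. -/

/-! ### Lattice duality and transference -/

/-- A character of an additive subgroup whose nonzero elements have norm at least `ρ` is induced
by the inner product with a vector of norm `O(1 / ρ)`. -/
theorem exists_inner_sub_intCast {G E : Type*} [AddCommGroup G] [NormedAddCommGroup E]
    [InnerProductSpace ℝ E] [FiniteDimensional ℝ E] (d : ℕ) (g : G →+ E) (χ : G →+ ℝ) (ρ : ℝ)
    (hρ : 0 < ρ) (hd : Module.finrank ℝ (Submodule.span ℝ (Set.range g)) ≤ d)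
    (hg : ∀ z, g z ≠ 0 → ρ ≤ ‖g z‖) (hχ : ∀ z, g z = 0 → ∃ k : ℤ, χ z = k) :
    ∃ x : E, ‖x‖ ≤ 4 ^ d / ρ ∧ ∀ z, ∃ k : ℤ, inner ℝ x (g z) - χ z = k := by
  induction d generalizing g χ ρ with
  | zero =>
    refine ⟨0, by simp; positivity, fun z => ?_⟩
    have h0 : Submodule.span ℝ (Set.range g) = ⊥ := by
      apply Submodule.finrank_eq_zero.mp; omega
    have hz : g z = 0 := by
      have : g z ∈ Submodule.span ℝ (Set.range g) := Submodule.subset_span ⟨z, rfl⟩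
      simpa [h0] using this
    obtain ⟨k, hk⟩ := hχ z hz
    exact ⟨-k, by simp [hk]⟩
  | succ d ih =>
    by_cases hall : ∀ z, g z = 0
    · refine ⟨0, by simp; positivity, fun z => ?_⟩
      obtain ⟨k, hk⟩ := hχ z (hall z)
      exact ⟨-k, by simp [hk]⟩
    push Not at hall
    set S : Set ℝ := {r | ∃ z, g z ≠ 0 ∧ ‖g z‖ = r} with hS
    have hSne : S.Nonempty := by
      obtain ⟨z, hz⟩ := hall
      exact ⟨_, z, hz, rfl⟩
    have hSbdd : BddBelow S := ⟨ρ, by rintro r ⟨z, hz, rfl⟩; exact hg z hz⟩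
    set r := sInf S with hr
    have hρr : ρ ≤ r := le_csInf hSne (by rintro r ⟨z, hz, rfl⟩; exact hg z hz)
    have hrmin : ∀ z, g z ≠ 0 → r ≤ ‖g z‖ := fun z hz => csInf_le hSbdd ⟨z, hz, rfl⟩
    have hr0 : 0 < r := hρ.trans_le hρr
    -- A nearly shortest vector is enough, so attainment of the infimum is not needed. The slack 5/4
    -- yields the 25/64 below: a rounding error of 1/2 times 5/4, squared.
    obtain ⟨_, ⟨z₀, hz₀, rfl⟩, hlt⟩ := exists_lt_of_csInf_lt hSne
      (show sInf S < 5 / 4 * r by rw [← hr]; linarith)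
    set w := g z₀ with hw
    have hwr : r ≤ ‖w‖ := hrmin z₀ hz₀
    have hw0 : 0 < ‖w‖ := hr0.trans_le hwr
    have hww : inner ℝ w w = ‖w‖ ^ 2 := real_inner_self_eq_norm_sq w
    -- the orthogonal projection to the complement of `w`
    let c : E → ℝ := fun v => inner ℝ w v / ‖w‖ ^ 2
    have hc_add : ∀ u v, c (u + v) = c u + c v := fun u v => by
      simp only [c, inner_add_right, add_div]
    have hc_smul : ∀ (a : ℝ) v, c (a • v) = a * c v := fun a v => by
      simp only [c, inner_smul_right, mul_div_assoc]
    let π : E →ₗ[ℝ] E :=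
      { toFun := fun v => v - c v • w
        map_add' := fun u v => by simp only [hc_add]; module
        map_smul' := fun a v => by simp only [hc_smul, RingHom.id_apply]; module }
    have hπ : ∀ v, π v = v - c v • w := fun v => rfl
    have hcw : c w = 1 := by simp only [c, hww]; field_simp
    have hπw : π w = 0 := by rw [hπ, hcw]; simp
    have hwπ : ∀ v, inner ℝ w (π v) = 0 := fun v => by
      rw [hπ, inner_sub_right, inner_smul_right, hww]; simp only [c]; field_simp; ring
    have hnorm : ∀ v, ‖v‖ ^ 2 = ‖π v‖ ^ 2 + c v ^ 2 * ‖w‖ ^ 2 := fun v => by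
      have h1 : v = π v + c v • w := by rw [hπ]; simp
      have h2 := norm_add_sq_real (π v) (c v • w)
      rw [← h1, inner_smul_right, real_inner_comm, hwπ, norm_smul, mul_pow, Real.norm_eq_abs,
        sq_abs] at h2
      linarith
    have hπself : ∀ u v, inner ℝ (π u) v = inner ℝ u (π v) := fun u v => by
      rw [hπ, hπ, inner_sub_left, inner_sub_right, real_inner_smul_left, real_inner_smul_right]
      simp only [c]; rw [real_inner_comm w u]; ring
    -- every element can be reduced modulo `w`
    have hred : ∀ z, ∃ m : ℤ, g (z - m • z₀) = g z - (m : ℝ) • w ∧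
        ‖g (z - m • z₀)‖ ^ 2 ≤ ‖π (g z)‖ ^ 2 + 25 / 64 * r ^ 2 := fun z => by
      refine ⟨round (c (g z)), ?_⟩
      have h1 : g (z - round (c (g z)) • z₀) = g z - (round (c (g z)) : ℝ) • w := by
        rw [map_sub, map_zsmul, Int.cast_smul_eq_zsmul]
      refine ⟨h1, ?_⟩
      rw [hnorm, h1, map_sub, map_smul, hπw, smul_zero, sub_zero]
      have h2 : c (g z - (round (c (g z)) : ℝ) • w) = c (g z) - round (c (g z)) := by
        rw [sub_eq_add_neg, ← neg_smul, hc_add, hc_smul, hcw]; ring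
      rw [h2]
      have h3 := abs_le.mp (abs_sub_round (c (g z)))
      have h4 : (c (g z) - round (c (g z))) ^ 2 ≤ 1 / 4 := by nlinarith
      have h5 : ‖w‖ ^ 2 ≤ 25 / 16 * r ^ 2 := by nlinarith
      have h6 := mul_le_mul h4 h5 (by positivity) (by norm_num)
      linarith
    -- the rounding error of the character at `z₀`
    set k := χ z₀ - round (χ z₀) with hk
    set x₀ : E := (k / ‖w‖ ^ 2) • w with hx₀
    have hk2 : |k| ≤ 1 / 2 := abs_sub_round _
    have hx₀w : inner ℝ x₀ w = k := by
      rw [hx₀, real_inner_smul_left, hww]; field_simp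
    have hx₀n : ‖x₀‖ ≤ 1 / 2 / ρ := by
      rw [hx₀, norm_smul, Real.norm_eq_abs, abs_div, abs_of_pos (pow_pos hw0 2)]
      calc |k| / ‖w‖ ^ 2 * ‖w‖ = |k| / ‖w‖ := by field_simp
        _ ≤ 1 / 2 / ρ := by gcongr; linarith
    let g' : G →+ E := π.toAddMonoidHom.comp g
    have hg'z : ∀ z, g' z = π (g z) := fun z => rfl
    let χ' : G →+ ℝ :=
      { toFun := fun z => χ z - inner ℝ x₀ (g z)
        map_zero' := by simp
        map_add' := fun a b => by simp only [map_add, inner_add_right]; ring }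
    have hχ'z : ∀ z, χ' z = χ z - inner ℝ x₀ (g z) := fun z => rfl
    have hfin : Module.finrank ℝ (Submodule.span ℝ (Set.range g')) ≤ d := by
      have hlt : Submodule.span ℝ (Set.range g') < Submodule.span ℝ (Set.range g) := by
        refine lt_of_le_of_ne (Submodule.span_le.mpr ?_) fun heq => ?_
        · rintro _ ⟨z, rfl⟩
          exact Submodule.sub_mem _ (Submodule.subset_span ⟨z, rfl⟩)
            (Submodule.smul_mem _ _ (Submodule.subset_span ⟨z₀, rfl⟩))
        · have h1 : w ∈ Submodule.span ℝ (Set.range g') := by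
            rw [heq]; exact Submodule.subset_span ⟨z₀, rfl⟩
          have h2 : ∀ v ∈ Submodule.span ℝ (Set.range g'), inner ℝ w v = 0 := fun v hv => by
            induction hv using Submodule.span_induction with
            | mem v hv => obtain ⟨z, rfl⟩ := hv; exact hwπ _
            | zero => simp
            | add u v _ _ hu hv => rw [inner_add_right, hu, hv, add_zero]
            | smul a v _ hv => rw [inner_smul_right, hv, mul_zero]
          have h3 := h2 w h1
          rw [hww] at h3
          exact (pow_pos hw0 2).ne' h3
      have := Submodule.finrank_lt_finrank_of_lt hlt
      omega
    -- After reduction modulo `w`, the lift of a projected vector has squared norm at least `r ^ 2`,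
    -- of which at most `25/64 * r ^ 2` lies along `w`. Hence projecting at most halves the minimum.
    have hg' : ∀ z, g' z ≠ 0 → ρ / 2 ≤ ‖g' z‖ := fun z hz => by
      rw [hg'z] at hz ⊢
      obtain ⟨m, h1, h2⟩ := hred z
      have h3 : g (z - m • z₀) ≠ 0 := fun h => hz (by
        have h4 : π (g z - (m : ℝ) • w) = 0 := by rw [← h1, h, map_zero]
        rwa [map_sub, map_smul, hπw, smul_zero, sub_zero] at h4)
      have h4 := hrmin _ h3
      by_contra! h5
      nlinarith [norm_nonneg (π (g z)), norm_nonneg (g (z - m • z₀))]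
    -- An element projecting to zero reduces modulo `z₀` to one of norm at most `5/8 * r`, hence to
    -- one killed by `g`.
    have hχ' : ∀ z, g' z = 0 → ∃ k : ℤ, χ' z = k := fun z hz => by
      rw [hg'z] at hz
      obtain ⟨m, h1, h2⟩ := hred z
      rw [hz, norm_zero] at h2
      have h3 : g (z - m • z₀) = 0 := by
        by_contra h
        have h4 := hrmin _ h
        nlinarith
      obtain ⟨k', hk'⟩ := hχ _ h3
      have h5 : χ' (z - m • z₀) = k' := by rw [hχ'z, hk', h3]; simp
      have h6 : χ' z₀ = (round (χ z₀) : ℤ) := by rw [hχ'z, hx₀w, hk]; ring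
      refine ⟨k' + m * round (χ z₀), ?_⟩
      rw [map_sub, map_zsmul, h6] at h5
      push_cast
      rw [← h5]; simp
    obtain ⟨y, hy, hyz⟩ := ih g' χ' (ρ / 2) (by positivity) hfin hg' hχ'
    refine ⟨x₀ + π y, ?_, fun z => ?_⟩
    · have h1 : ‖π y‖ ≤ ‖y‖ := by
        have := hnorm y
        refine abs_le_of_sq_le_sq' ?_ (norm_nonneg _) |>.2
        nlinarith [mul_nonneg (sq_nonneg (c y)) (sq_nonneg ‖w‖)]
      have h2 : (1 : ℝ) ≤ 4 ^ d := one_le_pow₀ (by norm_num)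
      calc ‖x₀ + π y‖ ≤ 1 / 2 / ρ + 4 ^ d / (ρ / 2) := (norm_add_le _ _).trans (by linarith)
        _ = (1 / 2 + 2 * 4 ^ d) / ρ := by field_simp
        _ ≤ 4 ^ (d + 1) / ρ := by gcongr; rw [pow_succ]; linarith
    · obtain ⟨k', hk'⟩ := hyz z
      refine ⟨k', ?_⟩
      rw [← hk', hg'z, hχ'z, inner_add_left, hπself]; ring

/-- Transference: if the simultaneous approximation system with parameters `X` and `δ` has no
nonzero solution, then integer linear forms can be found near every target. -/
theorem exists_int_linearForm_near {n : ℕ} (ξ : Fin n → ℝ) {X δ : ℝ} (hX : 0 < X) (hδ : 0 < δ)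
    (hno : ∀ (x : ℤ) (y : Fin n → ℤ), (x, y) ≠ 0 →
      X < |(x : ℝ)| ∨ ∃ i, δ < |ξ i * (x : ℝ) - (y i : ℝ)|) (t₀ : ℝ) (t : Fin n → ℝ) :
    ∃ (a₀ : ℤ) (a : Fin n → ℤ), |X * (a₀ + ∑ i, a i * ξ i) - t₀| ≤ 4 ^ (n + 1) ∧
      ∀ i, |δ * a i - t i| ≤ 4 ^ (n + 1) := by
  let g : ℤ × (Fin n → ℤ) →+ EuclideanSpace ℝ (Option (Fin n)) :=
    { toFun := fun z => WithLp.toLp 2 fun o =>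
        o.elim ((z.1 : ℝ) / X) fun i => ((z.2 i : ℝ) - ξ i * z.1) / δ
      map_zero' := by
        ext o; cases o <;> simp
      map_add' := fun u v => by
        ext o; cases o
        · simp [add_div]
        · simp only [Option.elim, Prod.snd_add, Prod.fst_add, Pi.add_apply, Int.cast_add,
            PiLp.add_apply]
          ring }
  have hg0 : ∀ z, g z none = (z.1 : ℝ) / X := fun z => rfl
  have hgi : ∀ z i, g z (some i) = ((z.2 i : ℝ) - ξ i * z.1) / δ := fun z i => rfl
  have hbig : ∀ z, z ≠ 0 → 1 ≤ ‖g z‖ := fun z hz => by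
    rcases hno z.1 z.2 hz with h | ⟨i, h⟩
    · refine le_trans ?_ (PiLp.norm_apply_le (g z) none)
      rw [hg0, Real.norm_eq_abs, abs_div, abs_of_pos hX, le_div_iff₀ hX]
      linarith
    · refine le_trans ?_ (PiLp.norm_apply_le (g z) (some i))
      rw [hgi, Real.norm_eq_abs, abs_div, abs_of_pos hδ, le_div_iff₀ hδ, abs_sub_comm]
      linarith
  -- With the character `-⟨T, ·⟩`, the vector `u` obtained below makes `u + T` pair integrally with
  -- the lattice: a dual vector at distance `‖u‖` from the target `T`.
  let T : EuclideanSpace ℝ (Option (Fin n)) := WithLp.toLp 2 fun o => o.elim t₀ t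
  let χ : ℤ × (Fin n → ℤ) →+ ℝ :=
    { toFun := fun z => -inner ℝ T (g z)
      map_zero' := by simp
      map_add' := fun u v => by rw [map_add, inner_add_right]; ring }
  obtain ⟨u, hu, huz⟩ := exists_inner_sub_intCast (n + 1) g χ 1 one_pos
    ((Submodule.finrank_le _).trans (by simp))
    (fun z hz => hbig z fun h => hz (by rw [h, map_zero]))
    (fun z hz => by
      have : z = 0 := by
        by_contra h
        have := hbig z h
        rw [hz, norm_zero] at this
        linarith
      exact ⟨0, by simp [this]⟩)
  have key : ∀ z, ∃ k : ℤ, inner ℝ (u + T) (g z) = k := fun z => by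
    obtain ⟨k, hk⟩ := huz z
    refine ⟨k, ?_⟩
    rw [← hk, inner_add_left]
    simp [χ]
  set v := u + T with hv
  have hvT : ∀ o, |v o - T o| ≤ 4 ^ (n + 1) := fun o => by
    have h1 : v o - T o = u o := by simp [hv]
    rw [h1, ← Real.norm_eq_abs]
    exact (PiLp.norm_apply_le u o).trans (by simpa using hu)
  have hinner : ∀ z, inner ℝ v (g z) = v none * ((z.1 : ℝ) / X) +
      ∑ i, v (some i) * (((z.2 i : ℝ) - ξ i * z.1) / δ) := fun z => by
    rw [PiLp.inner_apply, Fintype.sum_option]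
    simp only [hg0, hgi, RCLike.inner_apply, conj_trivial]
    congr 1
    · ring
    · exact Finset.sum_congr rfl fun i _ => by ring
  -- The integral pairings with the basis vectors are the coefficients of the linear form.
  obtain ⟨a₀, ha₀⟩ := key (1, 0)
  have hex : ∀ i, ∃ k : ℤ, v (some i) = δ * k := fun i => by
    obtain ⟨k, hk⟩ := key (0, Pi.single i 1)
    refine ⟨k, ?_⟩
    rw [hinner] at hk
    rw [← hk, Finset.sum_eq_single i]
    · simp; field_simp
    · intro j _ hj; simp [hj]
    · simp
  choose a ha using hex
  refine ⟨a₀, a, ?_, fun i => ?_⟩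
  · have h1 : X * (a₀ + ∑ i, a i * ξ i) = v none := by
      rw [← ha₀, hinner, add_assoc, ← Finset.sum_add_distrib, Finset.sum_eq_zero]
      · simp; field_simp
      · intro i _
        rw [ha i]; simp; field_simp; ring
    rw [h1]
    exact hvT none
  · have h1 := hvT (some i)
    rwa [ha i] at h1

/-! ### Heights and roots of integer polynomials -/

theorem primitiveMinpoly_ne_zero (α : ℂ) : primitiveMinpoly α ≠ 0 := by
  apply Polynomial.IsPrimitive.ne_zero
  exact isPrimitive_primPart _

theorem primitiveMinpoly_dvd {α : ℂ} {P : ℤ[X]} (hα : aeval α P = 0) :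
    primitiveMinpoly α ∣ P := by
  set q := IsLocalization.integerNormalization (nonZeroDivisors ℤ) (minpoly ℚ α) with hq
  obtain ⟨b, hbM, hb⟩ := IsLocalization.integerNormalization_spec (nonZeroDivisors ℤ)
    (minpoly ℚ α)
  have hb0 : (b : ℚ) ≠ 0 := Int.cast_ne_zero.mpr (nonZeroDivisors.ne_zero hbM)
  have h1 : q.map (Int.castRingHom ℚ) ∣ P.map (Int.castRingHom ℚ) := by
    rw [← algebraMap_int_eq, hb, ← Int.cast_smul_eq_zsmul ℚ, smul_eq_C_mul,
      (isUnit_C.mpr hb0.isUnit).mul_left_dvd]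
    exact minpoly.dvd ℚ α (by rw [aeval_map_algebraMap, hα])
  exact (IsPrimitive.Int.dvd_iff_map_cast_dvd_map_cast _ _ (isPrimitive_primPart q)).mpr
    ((Polynomial.map_dvd _ (primPart_dvd q)).trans h1)

theorem one_le_algHeight (α : ℂ) : 1 ≤ algHeight α := by
  have h := primitiveMinpoly_ne_zero α
  have h1 : (primitiveMinpoly α).natDegree ∈ (primitiveMinpoly α).support :=
    natDegree_mem_support_of_nonzero h
  refine le_trans ?_ (Finset.le_sup (f := fun i => ((primitiveMinpoly α).coeff i).natAbs) h1)
  rw [mem_support_iff] at h1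
  omega

/-- Mahler measure is multiplicative and at least 1 on the integral cofactor of the minimal
polynomial, so it does not grow on passing to that factor. It is compared with coefficients by
binomial bounds on one side and the sum of absolute values on the other. -/
theorem algHeight_le {n : ℕ} {α : ℂ} {P : ℤ[X]} {B : ℝ} (hP : P ≠ 0) (hn : P.natDegree ≤ n)
    (hα : aeval α P = 0) (hB : ∀ i, |(P.coeff i : ℝ)| ≤ B) :
    (algHeight α : ℝ) ≤ 2 ^ n * (n + 1) * B := by
  have hB0 : 0 ≤ B := (abs_nonneg _).trans (hB 0)
  obtain ⟨R, hR⟩ := primitiveMinpoly_dvd hα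
  set Q := primitiveMinpoly α with hQ
  have hR0 : R ≠ 0 := by rintro rfl; exact hP (by rw [hR, mul_zero])
  have hQ0 : Q ≠ 0 := by rintro h; exact hP (by rw [hR, h, zero_mul])
  have hdeg : Q.natDegree ≤ n := by
    rw [hR, natDegree_mul hQ0 hR0] at hn; omega
  have hM : (P.map (Int.castRingHom ℂ)).mahlerMeasure ≤ (n + 1) * B := by
    refine (mahlerMeasure_le_sum_norm_coeff _).trans ?_
    rw [Polynomial.sum_over_range' _ (fun _ => norm_zero) (n + 1)
      (lt_of_le_of_lt natDegree_map_le (by omega))]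
    refine (Finset.sum_le_card_nsmul _ _ B fun i _ => ?_).trans (by simp)
    simpa using hB i
  have hcoef : ∀ i, |(Q.coeff i : ℝ)| ≤ 2 ^ n * (n + 1) * B := fun i => by
    have h1 := norm_coeff_le_choose_mul_mahlerMeasure_of_one_le_mahlerMeasure i
      (Q.map (Int.castRingHom ℂ)) (R.map (Int.castRingHom ℂ)) (one_le_mahlerMeasure_of_ne_zero hR0)
    rw [← Polynomial.map_mul, ← hR, coeff_map, eq_intCast, Complex.norm_intCast] at h1
    refine h1.trans ?_
    rw [mul_assoc]
    refine mul_le_mul ?_ hM (mahlerMeasure_nonneg _) (by positivity)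
    have h2 : (Q.map (Int.castRingHom ℂ)).natDegree ≤ n := natDegree_map_le.trans hdeg
    exact_mod_cast (Nat.choose_le_two_pow _ _).trans (Nat.pow_le_pow_right (by norm_num) h2)
  obtain ⟨i, -, hi⟩ := Finset.exists_mem_eq_sup Q.support (nonempty_support_iff.mpr hQ0)
    fun i => (Q.coeff i).natAbs
  have h1 : algHeight α = (Q.coeff i).natAbs := hi
  rw [h1, Nat.cast_natAbs, Int.cast_abs]
  exact hcoef i

/-- A polynomial of degree at most `n` has a root within `n |f(x)| / |f'(x)|` of `x`. -/
theorem exists_root_norm_sub_le {n : ℕ} {f : ℂ[X]} {x : ℂ} (hn : f.natDegree ≤ n)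
    (hx : f.eval x ≠ 0) (hx' : f.derivative.eval x ≠ 0) :
    ∃ α, f.eval α = 0 ∧ ‖x - α‖ ≤ n * ‖f.eval x‖ / ‖f.derivative.eval x‖ := by
  by_contra! hcon
  have hf : f ≠ 0 := by rintro rfl; simp at hx
  set D := n * ‖f.eval x‖ / ‖f.derivative.eval x‖ with hD
  -- The logarithmic derivative is the sum of `1 / (x - z)` over at most `n` roots `z`; if all were
  -- farther than `D`, it would be smaller than `n / D`, which is its actual size.
  have h0 := (IsAlgClosed.splits f).eval_derivative_div_eval_of_ne_zero hx
  have hn0 : n ≠ 0 := by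
    rintro rfl
    rw [Nat.le_zero] at hn
    rw [eq_C_of_natDegree_eq_zero hn] at hx'
    simp at hx'
  have hDpos : 0 < D := by
    have := norm_pos_iff.mpr hx
    have := norm_pos_iff.mpr hx'
    positivity
  have hroots : f.roots ≠ 0 := by
    intro h
    rw [h] at h0
    simp at h0
    tauto
  have h1 : ‖f.derivative.eval x / f.eval x‖ < n / D := by
    rw [h0]
    have h2 : (f.roots.map fun z => ‖1 / (x - z)‖).sum < (f.roots.map fun _ => 1 / D).sum := by
      refine Multiset.sum_lt_sum_of_nonempty hroots fun z hz => ?_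
      rw [norm_div, norm_one]
      exact one_div_lt_one_div_of_lt hDpos (hcon z ((mem_roots hf).mp hz))
    refine (norm_multiset_sum_le _).trans_lt ?_
    rw [Multiset.map_map]
    refine h2.trans_le ?_
    rw [Multiset.map_const', Multiset.sum_replicate, nsmul_eq_mul, mul_one_div]
    gcongr
    exact (card_roots' f).trans hn
  have h3 : (n : ℝ) / D = ‖f.derivative.eval x / f.eval x‖ := by
    have := norm_pos_iff.mpr hx
    have := norm_pos_iff.mpr hx'
    rw [hD, norm_div]
    field_simp
  rw [h3] at h1
  exact lt_irrefl _ h1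

theorem AlgebraicOfDegreeLE.of_aeval_eq_zero {A : Type*} [Field A] [Algebra ℚ A] {n : ℕ} {x : A}
    {P : ℤ[X]} (hP : P ≠ 0) (hn : P.natDegree ≤ n) (hx : aeval x P = 0) :
    AlgebraicOfDegreeLE n x := by
  have h0 : P.map (Int.castRingHom ℚ) ≠ 0 := by
    rwa [Ne, Polynomial.map_eq_zero_iff (RingHom.injective_int _)]
  have h1 : aeval x (P.map (Int.castRingHom ℚ)) = 0 := by
    rw [← algebraMap_int_eq, aeval_map_algebraMap, hx]
  exact ⟨⟨_, h0, h1⟩, (natDegree_le_of_dvd (minpoly.dvd ℚ x h1) h0).trans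
    (natDegree_map_le.trans hn)⟩

/-- An integer polynomial small at `ζ` with large derivative there yields an algebraic number
close to `ζ`. -/
theorem exists_algebraic_near {n : ℕ} {ζ : ℝ} (hζ : ¬ AlgebraicOfDegreeLE n ζ) {P : ℤ[X]}
    (hn : P.natDegree ≤ n) {B ε D : ℝ} (hD : 0 < D) (hB : ∀ i, |(P.coeff i : ℝ)| ≤ B)
    (hε : |aeval ζ P| ≤ ε) (hP' : D ≤ |aeval ζ (derivative P)|) :
    ∃ α : ℂ, AlgebraicOfDegreeLE n α ∧ (algHeight α : ℝ) ≤ 2 ^ n * (n + 1) * B ∧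
      ‖(ζ : ℂ) - α‖ ≤ n * ε / D := by
  have hP : P ≠ 0 := by rintro rfl; simp at hP'; linarith
  have hζP : aeval ζ P ≠ 0 := fun h => hζ (.of_aeval_eq_zero hP hn h)
  have hev : ∀ R : ℤ[X], (R.map (Int.castRingHom ℂ)).eval (ζ : ℂ) = ((aeval ζ R : ℝ) : ℂ) :=
    fun R => by
      rw [← algebraMap_int_eq, eval_map_algebraMap]
      exact (aeval_algebraMap_apply ℂ ζ R)
  obtain ⟨α, hα, hle⟩ := exists_root_norm_sub_le (f := P.map (Int.castRingHom ℂ)) (x := (ζ : ℂ))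
    (natDegree_map_le.trans hn) (by rw [hev]; exact_mod_cast hζP)
    (by
      rw [derivative_map, hev, Complex.ofReal_ne_zero]
      intro h; rw [h, abs_zero] at hP'; linarith)
  rw [derivative_map, hev, hev, Complex.norm_real, Complex.norm_real, Real.norm_eq_abs,
    Real.norm_eq_abs] at hle
  have hα' : aeval α P = 0 := by rwa [← algebraMap_int_eq, eval_map_algebraMap] at hα
  refine ⟨α, .of_aeval_eq_zero hP hn hα', algHeight_le hP hn hα' hB, hle.trans ?_⟩
  have hε0 : 0 ≤ ε := (abs_nonneg _).trans hε
  gcongr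

/-! ### From approximations at scale `Q` to exponents -/

/-- There is an algebraic number of degree at most `n` and height at most `C * Q` whose distance
to `ζ` is at most `C * H(α)⁻¹ * Q ^ (-μ)`. -/
def HasAlgebraicApprox (n : ℕ) (ζ μ C Q : ℝ) : Prop :=
  ∃ α : ℂ, AlgebraicOfDegreeLE n α ∧ (algHeight α : ℝ) ≤ C * Q ∧
    ‖(ζ : ℂ) - α‖ ≤ C * (algHeight α : ℝ)⁻¹ * Q ^ (-μ)

theorem ereal_coe_le_of_forall_lt {μ : ℝ} (hμ : 0 < μ) {S : EReal}
    (h : ∀ μ' : ℝ, 0 ≤ μ' → μ' < μ → (μ' : EReal) ≤ S) : (μ : EReal) ≤ S := by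
  by_contra! hlt
  obtain ⟨r, h1, h2⟩ := EReal.lt_iff_exists_real_btwn.mp hlt
  have h3 := h (max r 0) (le_max_right _ _) (max_lt (EReal.coe_lt_coe_iff.mp h2) hμ)
  exact absurd (h1.trans_le (EReal.coe_le_coe_iff.mpr (le_max_left r 0))) h3.not_gt

/-- Constants are absorbed by a slightly smaller exponent. -/
theorem eventually_mul_rpow_neg_le {μ μ' A : ℝ} (h : μ' < μ) :
    ∀ᶠ Q : ℝ in atTop, A * Q ^ (-μ) ≤ Q ^ (-μ') := by
  have h1 := tendsto_rpow_atTop (sub_pos.mpr h)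
  filter_upwards [h1.eventually_ge_atTop A, eventually_gt_atTop 0] with Q hQ hQ0
  calc A * Q ^ (-μ) ≤ Q ^ (μ - μ') * Q ^ (-μ) := by gcongr
    _ = Q ^ (-μ') := by rw [← Real.rpow_add hQ0]; ring_nf

theorem le_wStar_of_frequently {n : ℕ} {ζ μ C : ℝ} (hζ : ¬ AlgebraicOfDegreeLE n ζ) (hμ : 0 < μ)
    (hC : 0 < C) (h : ∃ᶠ Q : ℝ in atTop, HasAlgebraicApprox n ζ μ C Q) :
    (μ : EReal) ≤ wStar n ζ := by
  refine ereal_coe_le_of_forall_lt hμ fun μ' hμ'0 hμ' => ?_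
  refine le_iSup₂_of_le μ' ?_ le_rfl
  intro hfin
  have hne : ∀ α : ℂ, AlgebraicOfDegreeLE n α → 0 < ‖(ζ : ℂ) - α‖ := fun α hα => by
    rw [norm_pos_iff, sub_ne_zero]
    rintro rfl
    refine hζ ⟨(isAlgebraic_algebraMap_iff (A := ℂ) Complex.ofReal_injective).mp hα.1, ?_⟩
    rw [← minpoly.algebraMap_eq (B' := ℂ) Complex.ofReal_injective ζ]
    exact hα.2
  -- Finitely many solutions would stay at a positive distance from `ζ`, while the approximations
  -- supplied at large `Q` are solutions arbitrarily close to `ζ`.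
  obtain ⟨d, hd0, hd⟩ : ∃ d > 0, ∀ α ∈ {α : ℂ | AlgebraicOfDegreeLE n α ∧
      ‖(ζ : ℂ) - α‖ ≤ (algHeight α : ℝ) ^ (-μ' - 1)}, d ≤ ‖(ζ : ℂ) - α‖ := by
    rcases Set.eq_empty_or_nonempty {α : ℂ | AlgebraicOfDegreeLE n α ∧
      ‖(ζ : ℂ) - α‖ ≤ (algHeight α : ℝ) ^ (-μ' - 1)} with he | he
    · exact ⟨1, one_pos, by rw [he]; simp⟩
    · obtain ⟨β, hβ, hmin⟩ := Set.exists_min_image _ (fun α => ‖(ζ : ℂ) - α‖) hfin he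
      exact ⟨_, hne β hβ.1, hmin⟩
  have hsmall : ∀ᶠ Q : ℝ in atTop, C * Q ^ (-μ) < d := by
    have h1 := (tendsto_rpow_neg_atTop hμ).const_mul C
    rw [mul_zero] at h1
    exact h1.eventually_lt_const hd0
  obtain ⟨Q, ⟨α, hα, hH, hle⟩, hQd, hQ, hQ0⟩ := (h.and_eventually (hsmall.and
    ((eventually_mul_rpow_neg_le (A := C * C ^ μ') hμ').and (eventually_gt_atTop 0)))).exists
  have hH1 : (1 : ℝ) ≤ algHeight α := by exact_mod_cast one_le_algHeight α
  have hH0 : (0 : ℝ) < algHeight α := one_pos.trans_le hH1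
  have hmem : ‖(ζ : ℂ) - α‖ ≤ (algHeight α : ℝ) ^ (-μ' - 1) := by
    have h1 : C * Q ^ (-μ) ≤ (C * Q) ^ (-μ') := by
      rw [Real.mul_rpow hC.le hQ0.le, Real.rpow_neg hC.le]
      have h2 : 0 < C ^ μ' := Real.rpow_pos_of_pos hC _
      rw [inv_mul_eq_div, le_div_iff₀ h2]
      linarith
    have h2 : (C * Q) ^ (-μ') ≤ (algHeight α : ℝ) ^ (-μ') :=
      Real.rpow_le_rpow_of_nonpos hH0 hH (by linarith)
    calc ‖(ζ : ℂ) - α‖ ≤ (C * Q ^ (-μ)) * (algHeight α : ℝ)⁻¹ := hle.trans (by linarith)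
      _ ≤ (algHeight α : ℝ) ^ (-μ') * (algHeight α : ℝ)⁻¹ := by gcongr; exact h1.trans h2
      _ = (algHeight α : ℝ) ^ (-μ' - 1) := by rw [Real.rpow_sub_one hH0.ne']; rfl
  have h3 := hd α ⟨hα, hmem⟩
  have h4 : C * (algHeight α : ℝ)⁻¹ * Q ^ (-μ) ≤ C * Q ^ (-μ) := by
    have h5 : (algHeight α : ℝ)⁻¹ ≤ 1 := inv_le_one_of_one_le₀ hH1
    have h6 : 0 < Q ^ (-μ) := Real.rpow_pos_of_pos hQ0 _
    have h7 : C * (algHeight α : ℝ)⁻¹ ≤ C * 1 := by gcongr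
    nlinarith
  linarith

theorem le_wHatStar_of_eventually {n : ℕ} {ζ μ C : ℝ} (hμ : 0 < μ) (hC : 0 < C)
    (h : ∀ᶠ Q : ℝ in atTop, HasAlgebraicApprox n ζ μ C Q) :
    (μ : EReal) ≤ wHatStar n ζ := by
  refine ereal_coe_le_of_forall_lt hμ fun μ' _ hμ' => ?_
  refine le_iSup₂_of_le μ' ?_ le_rfl
  -- Taking `Q = H / C` turns the height bound `C * Q` into exactly `H`.
  have ht : Tendsto (fun H : ℝ => H / C) atTop atTop := tendsto_id.atTop_div_const hC
  filter_upwards [ht.eventually h, eventually_mul_rpow_neg_le (A := C * C ^ μ) hμ',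
    eventually_gt_atTop 0] with H ⟨α, hα, hH, hle⟩ hb hH0
  refine ⟨α, hα, hH.trans_eq (by field_simp), hle.trans ?_⟩
  have h1 : C * (H / C) ^ (-μ) = C * C ^ μ * H ^ (-μ) := by
    rw [Real.div_rpow hH0.le hC.le, Real.rpow_neg hC.le μ]
    field_simp
  calc C * (algHeight α : ℝ)⁻¹ * (H / C) ^ (-μ)
      = (algHeight α : ℝ)⁻¹ * (C * (H / C) ^ (-μ)) := by ring
    _ ≤ (algHeight α : ℝ)⁻¹ * H ^ (-μ') := by rw [h1]; gcongr

/-! ### Construction of algebraic approximations -/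

/-- An integer polynomial that is small at `ζ`, and whose derivative there is comparable with its
height, has a root close to `ζ` relative to the height of that root. -/
theorem exists_algebraic_near_of_height_le {n : ℕ} {ζ : ℝ} (hζ : ¬ AlgebraicOfDegreeLE n ζ)
    {P : ℤ[X]} (hn : P.natDegree ≤ n) {A ε D : ℝ} (hD : 0 < D)
    (hB : ∀ i, |(P.coeff i : ℝ)| ≤ A * D) (hε : |aeval ζ P| ≤ ε)
    (hP' : D ≤ |aeval ζ (derivative P)|) :
    ∃ α : ℂ, AlgebraicOfDegreeLE n α ∧ (algHeight α : ℝ) ≤ 2 ^ n * (n + 1) * A * D ∧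
      ‖(ζ : ℂ) - α‖ ≤ n * (2 ^ n * (n + 1) * A) * (algHeight α : ℝ)⁻¹ * ε := by
  obtain ⟨α, hα, hH, hle⟩ := exists_algebraic_near hζ hn hD hB hε hP'
  have hH1 : (1 : ℝ) ≤ algHeight α := by exact_mod_cast one_le_algHeight α
  have hε0 : 0 ≤ ε := (abs_nonneg _).trans hε
  refine ⟨α, hα, by linarith, hle.trans ?_⟩
  rw [div_le_iff₀ hD]
  -- Since `H(α)` is at most a constant times `D`, the factor `1 / D` can be traded for `H(α)⁻¹`.
  have h1 : 1 ≤ (2 ^ n * (n + 1) * A * D) * (algHeight α : ℝ)⁻¹ := by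
    rw [← div_eq_mul_inv, le_div_iff₀ (by linarith)]
    linarith
  calc n * ε = n * ε * 1 := by ring
    _ ≤ n * ε * ((2 ^ n * (n + 1) * A * D) * (algHeight α : ℝ)⁻¹) := by gcongr
    _ = _ := by ring

/-- Rational approximations from Dirichlet's theorem already suffice. This makes both starred
exponents positive, as the product inequalities need when the other factor is infinite. -/
theorem eventually_hasAlgebraicApprox_one {n : ℕ} (hn : 1 ≤ n) {ζ : ℝ}
    (hζ : ¬ AlgebraicOfDegreeLE n ζ) :
    ∃ C > 0, ∀ᶠ Q : ℝ in atTop, HasAlgebraicApprox n ζ 1 C Q := by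
  set M : ℝ := 2 ^ n * (n + 1) * (|ζ| + 1) with hM
  have hM0 : 0 < M := by positivity
  have hn1 : (1 : ℝ) ≤ n := by exact_mod_cast hn
  refine ⟨n * M, by positivity, ?_⟩
  filter_upwards [eventually_ge_atTop 1] with Q hQ
  obtain ⟨j, k, hk0, hkN, hjk⟩ := Real.exists_int_int_abs_mul_sub_le ζ (Nat.floor_pos.mpr hQ)
  have hk1 : (1 : ℝ) ≤ k := by exact_mod_cast hk0
  have hkQ : (k : ℝ) ≤ Q :=
    (show (k : ℝ) ≤ (⌊Q⌋₊ : ℝ) by exact_mod_cast hkN).trans (Nat.floor_le (by linarith))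
  have hε : |k * ζ - j| ≤ Q⁻¹ := hjk.trans (by
    rw [one_div]
    exact inv_anti₀ (by linarith) (Nat.lt_floor_add_one Q).le)
  have hj : |(j : ℝ)| ≤ (|ζ| + 1) * k := by
    have h1 : |(j : ℝ)| ≤ |k * ζ| + |k * ζ - j| := by
      have := abs_sub (k * ζ) (k * ζ - j)
      simpa using this
    rw [abs_mul, abs_of_pos (by linarith : (0 : ℝ) < k)] at h1
    have h2 : Q⁻¹ ≤ 1 := inv_le_one_of_one_le₀ hQ
    linarith
  obtain ⟨α, hα, hH, hle⟩ := exists_algebraic_near_of_height_le hζ (P := C k * X + C (-j))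
    (A := |ζ| + 1) (ε := Q⁻¹) (D := k) (natDegree_linear_le.trans hn) (by linarith)
    (fun i => by
      rcases i with _ | _ | i
      · simpa using hj
      · simp only [coeff_add, coeff_C_mul, zero_add, coeff_X_one, coeff_C_succ, mul_one, add_zero]
        rw [abs_of_pos (by linarith)]
        nlinarith [abs_nonneg ζ]
      · have : (C k * X + C (-j)).coeff (i + 1 + 1) = 0 :=
          coeff_eq_zero_of_natDegree_lt (natDegree_linear_le.trans_lt (by omega))
        rw [this]; simp; positivity)
    (by simpa [sub_eq_add_neg] using hε) (by simp; exact le_abs_self _)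
  refine ⟨α, hα, hH.trans ?_, ?_⟩
  · rw [← hM]
    have : M * k ≤ M * Q := by gcongr
    nlinarith [mul_pos hM0 (one_pos.trans_le hQ)]
  · rwa [Real.rpow_neg_one]

/-- Unsolvability of the simultaneous approximation system at `X` yields a good algebraic
approximation at `X ^ ν`. -/
theorem exists_hasAlgebraicApprox_of_not_simulSolvable {n : ℕ} (hn : 1 ≤ n) {ζ : ℝ}
    (hζ : ¬ AlgebraicOfDegreeLE n ζ) {ν : ℝ} (hν : 0 < ν) :
    ∃ C > 0, ∀ X : ℝ, 1 ≤ X → ¬ SimulSolvable (powerVec n ζ) ν X →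
      HasAlgebraicApprox n ζ (1 / ν) C (X ^ ν) := by
  set K : ℝ := 4 ^ (n + 1) with hK
  have hK1 : 1 ≤ K := one_le_pow₀ (by norm_num)
  set Z : ℝ := ∑ i : Fin n, |((i : ℝ) + 1) * ζ ^ (i : ℕ)| with hZ
  set W : ℝ := ∑ i : Fin n, |powerVec n ζ i| with hW
  have hZ0 : 0 ≤ Z := Finset.sum_nonneg fun _ _ => abs_nonneg _
  have hW0 : 0 ≤ W := Finset.sum_nonneg fun _ _ => abs_nonneg _
  -- The linear coefficient, whose weight in `P'(ζ)` is 1, is aimed at `Q * B`; deviations of at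
  -- most `K * Q` per coefficient change `P'(ζ)` by at most `K * Q * Z`, leaving at least `Q`.
  set B : ℝ := K * Z + 1 with hB
  set A : ℝ := (K + B) * (1 + W) with hA
  have hB0 : 0 < B := by positivity
  have hA0 : 0 < A := by positivity
  set M : ℝ := 2 ^ n * (n + 1) * A with hM
  have hM0 : 0 < M := by positivity
  have hn1 : (1 : ℝ) ≤ n := by exact_mod_cast hn
  refine ⟨n * M * K, by positivity, fun Y hY hno => ?_⟩
  set Q : ℝ := Y ^ ν with hQ
  have hY0 : 0 < Y := by linarith
  have hQ1 : 1 ≤ Q := Real.one_le_rpow hY hν.le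
  have hQ0 : 0 < Q := by linarith
  have hδ : Y ^ (-ν) = Q⁻¹ := Real.rpow_neg hY0.le ν
  let i₀ : Fin n := ⟨0, hn⟩
  obtain ⟨a₀, a, h0, ha⟩ := exists_int_linearForm_near (powerVec n ζ) hY0 (inv_pos.mpr hQ0)
    (fun x y hxy => by
      by_contra! hcon
      refine hno ⟨x, y, hxy, hcon.1, fun i => ?_⟩
      rw [hδ]
      exact hcon.2 i) 0 (Pi.single i₀ B)
  rw [sub_zero, abs_mul, abs_of_pos hY0, ← hK] at h0
  have ha' : ∀ i, |(a i : ℝ) - Q * (Pi.single i₀ B : Fin n → ℝ) i| ≤ K * Q := fun i => by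
    have h1 : (a i : ℝ) - Q * (Pi.single i₀ B : Fin n → ℝ) i =
        (Q⁻¹ * a i - (Pi.single i₀ B : Fin n → ℝ) i) * Q := by field_simp
    rw [h1, abs_mul, abs_of_pos hQ0]
    gcongr
    exact ha i
  have hsingle : ∀ i, |(Pi.single i₀ B : Fin n → ℝ) i| ≤ B := fun i => by
    rcases eq_or_ne i i₀ with rfl | hi
    · rw [Pi.single_eq_same, abs_of_pos hB0]
    · rw [Pi.single_eq_of_ne hi, abs_zero]; exact hB0.le
  have haB : ∀ i, |(a i : ℝ)| ≤ (K + B) * Q := fun i => by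
    have h1 := abs_add_le ((a i : ℝ) - Q * (Pi.single i₀ B : Fin n → ℝ) i)
      (Q * (Pi.single i₀ B : Fin n → ℝ) i)
    rw [sub_add_cancel, abs_mul Q, abs_of_pos hQ0] at h1
    have h2 : Q * |(Pi.single i₀ B : Fin n → ℝ) i| ≤ Q * B := by gcongr; exact hsingle i
    linarith [ha' i]
  have hval : |(a₀ : ℝ) + ∑ i, a i * powerVec n ζ i| ≤ K * Y⁻¹ := by
    rw [← div_eq_mul_inv, le_div_iff₀ hY0]
    linarith
  have ha₀ : |(a₀ : ℝ)| ≤ A * Q := by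
    have h1 := abs_sub ((a₀ : ℝ) + ∑ i, a i * powerVec n ζ i) (∑ i, a i * powerVec n ζ i)
    rw [add_sub_cancel_right] at h1
    have h2 : |∑ i, (a i : ℝ) * powerVec n ζ i| ≤ (K + B) * Q * W := by
      rw [hW, Finset.mul_sum]
      refine (Finset.abs_sum_le_sum_abs _ _).trans (Finset.sum_le_sum fun i _ => ?_)
      rw [abs_mul]
      gcongr
      exact haB i
    have h3 : Y⁻¹ ≤ 1 := inv_le_one_of_one_le₀ hY
    have h4 : K * Y⁻¹ ≤ (K + B) * Q := by
      calc K * Y⁻¹ ≤ (K + B) * 1 := by gcongr; linarith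
        _ ≤ (K + B) * Q := by gcongr
    rw [hA]
    linarith
  set P : ℤ[X] := C a₀ + ∑ i : Fin n, C (a i) * X ^ ((i : ℕ) + 1) with hP
  have hdeg : P.natDegree ≤ n := by
    refine natDegree_add_le_of_degree_le (by simp) (natDegree_sum_le_of_forall_le _ _ fun i _ => ?_)
    exact (natDegree_C_mul_X_pow_le _ _).trans i.isLt
  have hcoeff : ∀ m, |(P.coeff m : ℝ)| ≤ A * Q := fun m => by
    rcases m with _ | m
    · have h1 : P.coeff 0 = a₀ := by simp [hP]
      rw [h1]; exact ha₀
    · by_cases hm : m < n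
      · have h1 : P.coeff (m + 1) = a ⟨m, hm⟩ := by
          rw [hP, coeff_add, coeff_C_succ, zero_add, finsetSum_coeff,
            Finset.sum_eq_single ⟨m, hm⟩]
          · simp
          · intro i _ hi
            rw [coeff_C_mul_X_pow, if_neg]
            rintro h
            exact hi (Fin.ext (by simpa using h.symm))
          · simp
        rw [h1, hA]
        refine (haB _).trans ?_
        gcongr
        nlinarith
      · rw [coeff_eq_zero_of_natDegree_lt (by omega)]
        simp; positivity
  have haeval : aeval ζ P = (a₀ : ℝ) + ∑ i, a i * powerVec n ζ i := by
    simp [hP, powerVec]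
  have hder : aeval ζ (derivative P) = ∑ i : Fin n, (a i : ℝ) * (((i : ℝ) + 1) * ζ ^ (i : ℕ)) := by
    simp [hP]
  have hder' : Q ≤ |aeval ζ (derivative P)| := by
    rw [hder]
    have h1 : ∑ i : Fin n, (a i : ℝ) * (((i : ℝ) + 1) * ζ ^ (i : ℕ)) =
        ∑ i : Fin n, ((a i : ℝ) - Q * (Pi.single i₀ B : Fin n → ℝ) i) *
          (((i : ℝ) + 1) * ζ ^ (i : ℕ)) + Q * B := by
      rw [← sub_eq_iff_eq_add', ← Finset.sum_sub_distrib, Finset.sum_eq_single i₀]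
      · simp [i₀]
      · intro i _ hi
        rw [Pi.single_eq_of_ne hi]; ring
      · simp
    have h2 : |∑ i : Fin n, ((a i : ℝ) - Q * (Pi.single i₀ B : Fin n → ℝ) i) *
          (((i : ℝ) + 1) * ζ ^ (i : ℕ))| ≤ K * Q * Z := by
      rw [hZ, Finset.mul_sum]
      refine (Finset.abs_sum_le_sum_abs _ _).trans (Finset.sum_le_sum fun i _ => ?_)
      rw [abs_mul]
      gcongr
      exact ha' i
    rw [h1]
    refine le_trans ?_ (le_abs_self _)
    have h3 := (abs_le.mp h2).1
    rw [hB]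
    linarith
  obtain ⟨α, hα, hH, hle⟩ := exists_algebraic_near_of_height_le hζ hdeg hQ0 hcoeff
    (ε := K * Y⁻¹) (by rw [haeval]; exact hval) hder'
  have hQY : Q ^ (-(1 / ν)) = Y⁻¹ := by
    rw [hQ, ← Real.rpow_mul hY0.le, mul_neg, mul_one_div_cancel hν.ne', Real.rpow_neg_one]
  refine ⟨α, hα, hH.trans ?_, ?_⟩
  · rw [← hM]
    gcongr
    calc M = 1 * M * 1 := by ring
      _ ≤ n * M * K := by gcongr
  · rw [hQY]
    refine hle.trans_eq ?_
    rw [← hM]; ring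

/-! ### Positivity of the simultaneous exponents -/

/-- Dirichlet's theorem on simultaneous approximation. -/
theorem exists_int_simul_approx {n : ℕ} (ξ : Fin n → ℝ) {N : ℕ} (hN : 0 < N) :
    ∃ (x : ℤ) (y : Fin n → ℤ), 0 < x ∧ x ≤ N ^ n ∧ ∀ i, |ξ i * x - y i| ≤ 1 / N := by
  have hN' : (0 : ℝ) < N := by exact_mod_cast hN
  -- Pigeonhole: `N ^ n + 1` multiples fall into `N ^ n` boxes of side `1 / N`.
  let f : ℕ → Fin n → ℤ := fun m i => ⌊Int.fract (ξ i * m) * N⌋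
  have hmaps : ∀ m ∈ Finset.range (N ^ n + 1),
      f m ∈ Fintype.piFinset fun _ : Fin n => Finset.Ico (0 : ℤ) N := fun m _ => by
    rw [Fintype.mem_piFinset]
    intro i
    rw [Finset.mem_Ico]
    constructor
    · exact Int.floor_nonneg.mpr (mul_nonneg (Int.fract_nonneg _) hN'.le)
    · rw [Int.floor_lt]
      exact_mod_cast mul_lt_of_lt_one_left hN' (Int.fract_lt_one (ξ i * m))
  have hex : ∃ a b : ℕ, a < b ∧ b ≤ N ^ n ∧ f a = f b := by
    obtain ⟨a, ha, b, hb, hab, hf⟩ := Finset.exists_ne_map_eq_of_card_lt_of_maps_to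
      (by simp) hmaps
    rw [Finset.mem_range] at ha hb
    rcases lt_or_gt_of_ne hab with h | h
    · exact ⟨a, b, h, by omega, hf⟩
    · exact ⟨b, a, h, by omega, hf.symm⟩
  obtain ⟨a, b, hab, hb, hf⟩ := hex
  refine ⟨(b : ℤ) - a, fun i => ⌊ξ i * b⌋ - ⌊ξ i * a⌋, by omega, ?_, fun i => ?_⟩
  · have : (b : ℤ) ≤ N ^ n := by exact_mod_cast hb
    omega
  · have h1 := (Int.abs_sub_lt_one_of_floor_eq_floor (congrFun hf i)).le
    rw [← sub_mul, abs_mul, abs_of_pos hN', ← le_div_iff₀ hN', abs_sub_comm] at h1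
    refine le_trans (le_of_eq ?_) h1
    congr 1
    push_cast
    simp only [Int.fract]
    ring

/-- Any positive exponent serves for positivity; half of Dirichlet's `1 / n` leaves room to round `X
^ ν` up to an integer, which is at most `X ^ (2 * ν)`. -/
theorem eventually_simulSolvable {n : ℕ} (hn : 1 ≤ n) (ξ : Fin n → ℝ) :
    ∀ᶠ X : ℝ in atTop, SimulSolvable ξ (1 / (2 * n)) X := by
  have hn0 : (0 : ℝ) < n := by exact_mod_cast hn
  set ν : ℝ := 1 / (2 * n) with hν
  have hν0 : 0 < ν := by positivity
  filter_upwards [(tendsto_rpow_atTop hν0).eventually_ge_atTop 2, eventually_gt_atTop 0]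
    with X hX hX0
  have hceil := Nat.le_ceil (X ^ ν)
  obtain ⟨x, y, hx0, hxN, hxy⟩ := exists_int_simul_approx ξ
    (Nat.ceil_pos.mpr (by linarith : 0 < X ^ ν))
  refine ⟨x, y, fun h => ?_, ?_, fun i => (hxy i).trans ?_⟩
  · rw [Prod.mk_eq_zero] at h; omega
  · have hx0' : (0 : ℝ) < x := by exact_mod_cast hx0
    rw [abs_of_pos hx0']
    have h1 : (x : ℝ) ≤ (⌈X ^ ν⌉₊ : ℝ) ^ n := by exact_mod_cast hxN
    have h2 : (⌈X ^ ν⌉₊ : ℝ) ≤ X ^ ν * X ^ ν := by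
      nlinarith [Nat.ceil_lt_add_one (by linarith : 0 ≤ X ^ ν)]
    calc (x : ℝ) ≤ (⌈X ^ ν⌉₊ : ℝ) ^ n := h1
      _ ≤ (X ^ ν * X ^ ν) ^ n := by gcongr
      _ = X := by
        rw [← Real.rpow_add hX0, ← Real.rpow_natCast, ← Real.rpow_mul hX0.le, hν]
        rw [show (1 / (2 * (n : ℝ)) + 1 / (2 * n)) * n = 1 by field_simp; norm_num,
          Real.rpow_one]
  · rw [Real.rpow_neg hX0.le, one_div]
    exact inv_anti₀ (by linarith) hceil

theorem wHatPrime_pos {n : ℕ} (hn : 1 ≤ n) (ζ : ℝ) : 0 < wHatPrime n ζ := by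
  have hn0 : (0 : ℝ) < n := by exact_mod_cast hn
  refine lt_of_lt_of_le ?_ (le_iSup₂_of_le _ (eventually_simulSolvable hn (powerVec n ζ)) le_rfl)
  exact_mod_cast (by positivity : (0 : ℝ) < 1 / (2 * n))

theorem wHatPrime_le_wPrime (n : ℕ) (ζ : ℝ) : wHatPrime n ζ ≤ wPrime n ζ :=
  iSup₂_le fun ν hν => le_iSup₂_of_le ν hν.frequently le_rfl

/-! ### Comparison of the exponents -/

theorem one_div_le_wStar {n : ℕ} (hn : 1 ≤ n) {ζ : ℝ} (hζ : ¬ AlgebraicOfDegreeLE n ζ) {ν : ℝ}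
    (hν : 0 < ν) (h : wHatPrime n ζ < ν) : ((1 / ν : ℝ) : EReal) ≤ wStar n ζ := by
  obtain ⟨C, hC, hX⟩ := exists_hasAlgebraicApprox_of_not_simulSolvable hn hζ hν
  refine le_wStar_of_frequently hζ (one_div_pos.mpr hν) hC ?_
  have h1 : ∃ᶠ X : ℝ in atTop, ¬ SimulSolvable (powerVec n ζ) ν X := fun hev => by
    simp only [not_not] at hev
    exact h.not_ge (le_iSup₂_of_le ν hev le_rfl)
  exact (tendsto_rpow_atTop hν).frequently ((h1.and_eventually (eventually_ge_atTop 1)).mono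
    fun X hX' => hX X hX'.2 hX'.1)

theorem one_div_le_wHatStar {n : ℕ} (hn : 1 ≤ n) {ζ : ℝ} (hζ : ¬ AlgebraicOfDegreeLE n ζ) {ν : ℝ}
    (hν : 0 < ν) (h : wPrime n ζ < ν) : ((1 / ν : ℝ) : EReal) ≤ wHatStar n ζ := by
  obtain ⟨C, hC, hX⟩ := exists_hasAlgebraicApprox_of_not_simulSolvable hn hζ hν
  refine le_wHatStar_of_eventually (one_div_pos.mpr hν) hC ?_
  have h1 : ∀ᶠ X : ℝ in atTop, ¬ SimulSolvable (powerVec n ζ) ν X := by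
    by_contra hev
    exact h.not_ge (le_iSup₂_of_le ν hev le_rfl)
  -- Every large `Q` is reached, as `X ^ ν` with `X = Q ^ (1 / ν)`.
  filter_upwards [(tendsto_rpow_atTop (one_div_pos.mpr hν)).eventually
    (h1.and (eventually_ge_atTop 1)), eventually_gt_atTop 0] with Q hQ hQ0
  have h2 := hX _ hQ.2 hQ.1
  rwa [← Real.rpow_mul hQ0.le, one_div_mul_cancel hν.ne', Real.rpow_one] at h2

/-- For finite `W`, let `ν` decrease to `W`. For `W = ⊤` the family `h` is vacuous, and `0 < S`
alone gives both claims. -/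
theorem one_div_le_and_one_le_mul {S W : EReal} (hW : 0 < W) (hS : 0 < S)
    (h : ∀ ν : ℝ, 0 < ν → W < ν → ((1 / ν : ℝ) : EReal) ≤ S) : 1 / W ≤ S ∧ 1 ≤ S * W := by
  induction W with
  | bot => simp at hW
  | top => simp [EReal.mul_top_of_pos hS, hS.le]
  | coe r =>
    have hr : 0 < r := by exact_mod_cast hW
    have h1 : ((1 / r : ℝ) : EReal) ≤ S := by
      refine ereal_coe_le_of_forall_lt (one_div_pos.mpr hr) fun μ hμ0 hμ => ?_
      rcases hμ0.eq_or_lt with rfl | hμ0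
      · exact hS.le
      · have h2 := h (1 / μ) (one_div_pos.mpr hμ0)
          (EReal.coe_lt_coe_iff.mpr ((lt_one_div hμ0 hr).mp hμ))
        rwa [one_div_one_div] at h2
    refine ⟨by exact_mod_cast h1, ?_⟩
    calc (1 : EReal) = ((1 / r : ℝ) : EReal) * (r : EReal) := by
          rw [← EReal.coe_mul, one_div_mul_cancel hr.ne', EReal.coe_one]
      _ ≤ S * r := mul_le_mul_of_nonneg_right h1 hW.le

end DiophApprox

theorem theorem2 (n : ℕ) (hn : 1 ≤ n) (ζ : ℝ)
    (hζ : ¬ DiophApprox.AlgebraicOfDegreeLE n ζ) :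
    (0 < DiophApprox.wHatPrime n ζ ∧ 0 < DiophApprox.wPrime n ζ) ∧
    (1 / DiophApprox.wHatPrime n ζ ≤ DiophApprox.wStar n ζ ∧
      1 / DiophApprox.wPrime n ζ ≤ DiophApprox.wHatStar n ζ) ∧
    (1 ≤ DiophApprox.wStar n ζ * DiophApprox.wHatPrime n ζ ∧
      1 ≤ DiophApprox.wHatStar n ζ * DiophApprox.wPrime n ζ) := by
  have h1 := DiophApprox.wHatPrime_pos hn ζ
  have h2 := h1.trans_le (DiophApprox.wHatPrime_le_wPrime n ζ)
  obtain ⟨C, hC, hev⟩ := DiophApprox.eventually_hasAlgebraicApprox_one hn hζ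
  have h3 : 0 < DiophApprox.wStar n ζ :=
    lt_of_lt_of_le (by simp) (DiophApprox.le_wStar_of_frequently hζ one_pos hC hev.frequently)
  have h4 : 0 < DiophApprox.wHatStar n ζ :=
    lt_of_lt_of_le (by simp) (DiophApprox.le_wHatStar_of_eventually one_pos hC hev)
  obtain ⟨h5, h6⟩ := DiophApprox.one_div_le_and_one_le_mul h1 h3
    fun ν hν h => DiophApprox.one_div_le_wStar hn hζ hν h
  obtain ⟨h7, h8⟩ := DiophApprox.one_div_le_and_one_le_mul h2 h4
    fun ν hν h => DiophApprox.one_div_le_wHatStar hn hζ hν h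
  exact ⟨⟨h1, h2⟩, ⟨h5, h7⟩, ⟨h6, h8⟩⟩
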